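/- All graphs are finite, simple and undirected. For a graph $G$ with adjacency matrix $A(G)$, let $\phi(G)=\phi(G,\lambda)=\det(\lambda I-A(G))$ denote its characteristic polynomial. Let $P_r$ and $C_r$ denote the path and the cycle with $r$ vertices, labelled $0,1,\dots,r-1$ so that consecutive labels correspond to adjacent vertices (and, in $C_r$, also $r-1$ is adjacent to $0$). For $n\geq 10$, let $H_n=P_{2,2;n-4}^{2,n-7}$ be the tree with $n$ vertices obtained from the path $P_{n-4}$ by attaching a pendant path with $2$ edges at the vertex $2$ and a pendant path with $2$ edges at the vertex $n-7$. For integers $t\geq 1$, $s\geq 2$ and $1\leq k\leq s$, let $C_{1,t;2s}^{0,k}$ be the closed quipu obtained from the cycle $C_{2s}$ by attaching a pendant path with $1$ edge at the vertex $0$ and a pendant path with $t$ edges at the vertex $k$. Let $n\geq 12$. Then there exist no integers $t,s,k$ with $t>1$, $s>3$ and $1<k\leq s$ such that $$\phi\bigl(C_{1,t;2s}^{0,k}\bigr)=(\lambda^2-1)^{-1}\,\phi(H_n),$$ that is, such that $(\lambda^2-1)\,\phi\bigl(C_{1,t;2s}^{0,k}\bigr)=\phi(H_n)$. -/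

import Mathlib

open Polynomial

/-- The graph obtained from a graph `B` on the vertices `0, …, r - 1` by attaching, for each `i`,
a pendant path with `n i` edges at the vertex `m i` of `B`.  The new vertices of the `i`-th path are
`Sum.inr ⟨i, 0⟩, …, Sum.inr ⟨i, n i - 1⟩`, listed from the attachment vertex outwards. -/
def attachPaths {r t : ℕ} (B : SimpleGraph (Fin r)) (n m : Fin t → ℕ) :
    SimpleGraph (Fin r ⊕ (Σ i : Fin t, Fin (n i))) where
  Adj
    | .inl u, .inl v => B.Adj u v
    | .inl u, .inr p => (u : ℕ) = m p.1 ∧ (p.2 : ℕ) = 0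
    | .inr p, .inl u => (u : ℕ) = m p.1 ∧ (p.2 : ℕ) = 0
    | .inr p, .inr q =>
        p.1 = q.1 ∧ ((p.2 : ℕ) + 1 = (q.2 : ℕ) ∨ (q.2 : ℕ) + 1 = (p.2 : ℕ))
  symm := ⟨by
    rintro (u | p) (v | q) h
    · exact SimpleGraph.Adj.symm h
    · exact h
    · exact h
    · exact ⟨h.1.symm, h.2.symm⟩⟩
  loopless := ⟨by
    rintro (u | p) h
    · exact B.irrefl h
    · rcases h.2 with h | h <;> omega⟩

/-- The open quipu `P_{n₁,…,n_t; r}^{m₁,…,m_t}` (meaningful for `0 < m₁ < ⋯ < m_t < r - 1`). -/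
def openQuipu {t : ℕ} (n m : Fin t → ℕ) (r : ℕ) :
    SimpleGraph (Fin r ⊕ (Σ i : Fin t, Fin (n i))) :=
  attachPaths (SimpleGraph.pathGraph r) n m

/-- The closed quipu `C_{n₁,…,n_t; r}^{m₁,…,m_t}`
(meaningful for `3 ≤ r` and `0 ≤ m₁ < ⋯ < m_t ≤ r - 1`). -/
def closedQuipu {t : ℕ} (n m : Fin t → ℕ) (r : ℕ) :
    SimpleGraph (Fin r ⊕ (Σ i : Fin t, Fin (n i))) :=
  attachPaths (SimpleGraph.cycleGraph r) n m

/-- The tree `H_n = P_{2,2; n-4}^{2, n-7}` (considered for `n ≥ 10`). -/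
def treeH (n : ℕ) : SimpleGraph (Fin (n - 4) ⊕ (Σ i : Fin 2, Fin (![2, 2] i))) :=
  openQuipu ![2, 2] ![2, n - 7] (n - 4)

open scoped Classical in
/-- The characteristic polynomial `φ(G) = det (X I - A(G))` of a finite graph. -/
noncomputable def graphCharpoly {V : Type*} [Fintype V] [DecidableEq V] (G : SimpleGraph V) :
    ℝ[X] :=
  (G.adjMatrix ℝ).charpoly

open scoped Matrix


/-! Comparing degrees forces n = 2s + t + 3. Put λ = z + 1/z with 0 < z < 1. The path and cycle
matrices then have explicit determinants and Green functions, and attaching two pendant paths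
multiplies determinants and adds a 2×2 correction (`det_charMat_attachPaths`). Both sides become
Laurent polynomials in z. After clearing nonvanishing factors, their difference is `quipuResidual`,
an honest polynomial in z because t ≥ 2, s ≥ 4 and 2 ≤ k ≤ s. It would vanish on (0,1), hence at z =
0 (that is, λ → ∞). But its value there is 2, minus 1 if t = 2, plus 2 if s = 4, plus 1 if k = 2, so
it is at least 1. -/

/-- The matrix `l I - A(G)`. -/
noncomputable def charMat {V : Type*} [DecidableEq V] (G : SimpleGraph V) (l : ℝ) :
    Matrix V V ℝ :=
  open scoped Classical in
  Matrix.of fun u v => (if u = v then l else 0) - if G.Adj u v then 1 else 0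

lemma eval_graphCharpoly {V : Type*} [Fintype V] [DecidableEq V] (G : SimpleGraph V) (l : ℝ) :
    (graphCharpoly G).eval l = (charMat G l).det := by
  classical
  rw [graphCharpoly, Matrix.eval_charpoly]
  congr 1

/-! ### Determinants of graphs with pendant paths. -/

/-- If `M w = c eᵢ`, then `det M` is determined by the principal minor at `i`. -/
lemma det_mul_apply_of_mulVec_eq_single {V : Type*} [Fintype V] [DecidableEq V]
    (M : Matrix V V ℝ) (w : V → ℝ) (c : ℝ) (i : V) (h : M *ᵥ w = Pi.single i c) :
    M.det * w i = c * M.adjugate i i := by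
  have h1 : M.adjugate *ᵥ (M *ᵥ w) = M.det • w := by
    rw [Matrix.mulVec_mulVec, Matrix.adjugate_mul, Matrix.smul_mulVec, Matrix.one_mulVec]
  have h2 := congrFun h1 i
  rw [h, Matrix.mulVec_single] at h2
  simp at h2
  rw [← h2, mul_comm]

lemma det_blockDiagonal_dependent {o : Type*} [Fintype o] [LinearOrder o] {m : o → Type*}
    [∀ i, Fintype (m i)] [∀ i, DecidableEq (m i)] (M : ∀ i, Matrix (m i) (m i) ℝ) :
    (Matrix.blockDiagonal' M).det = ∏ i, (M i).det := by
  rw [(Matrix.blockTriangular_blockDiagonal' M).det_fintype]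
  refine Finset.prod_congr rfl fun i _ => ?_
  rw [← Matrix.det_submatrix_equiv_self (Equiv.sigmaSubtype i).symm]
  congr 1
  ext a b
  simp [Matrix.toSquareBlock, Matrix.toSquareBlockProp, Equiv.sigmaSubtype]

/-- The characteristic determinant of a graph with two pendant paths attached, in terms of
solutions of linear equations on the base graph and on the paths. -/
lemma det_charMat_attachPaths {r : ℕ} (B : SimpleGraph (Fin r)) (n m : Fin 2 → ℕ) (l : ℝ)
    (v : Fin 2 → Fin r) (hv : ∀ i, (v i : ℕ) = m i)
    (g : Fin 2 → Fin r → ℝ) (hg : ∀ i, charMat B l *ᵥ g i = Pi.single (v i) 1)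
    (o : ∀ i, Fin (n i)) (ho : ∀ i, (o i : ℕ) = 0)
    (h : ∀ i, Fin (n i) → ℝ)
    (hh : ∀ i, charMat (SimpleGraph.pathGraph (n i)) l *ᵥ h i = Pi.single (o i) 1) :
    (charMat (attachPaths B n m) l).det =
      (charMat B l).det * (charMat (SimpleGraph.pathGraph (n 0)) l).det *
        (charMat (SimpleGraph.pathGraph (n 1)) l).det *
        ((1 - h 0 (o 0) * g 0 (v 0)) * (1 - h 1 (o 1) * g 1 (v 1)) -
          h 0 (o 0) * h 1 (o 1) * g 0 (v 1) * g 1 (v 0)) := by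
  classical
  have hvm : ∀ i (u : Fin r), (u : ℕ) = m i ↔ u = v i := fun i u => by
    rw [← hv i, Fin.ext_iff]
  have hom : ∀ i (u : Fin (n i)), (u : ℕ) = 0 ↔ u = o i := fun i u => by
    rw [← ho i, Fin.ext_iff]
  set M := charMat B l with hM
  set D := Matrix.blockDiagonal' fun i => charMat (SimpleGraph.pathGraph (n i)) l with hD
  let Bm : Matrix (Fin r) (Σ i : Fin 2, Fin (n i)) ℝ :=
    Matrix.of fun u p => if u = v p.1 ∧ p.2 = o p.1 then -1 else 0
  -- `W` solves D W = -Bmᵀ, which gives the Schur complement of `D` without inverting it.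
  let W : Matrix (Σ i : Fin 2, Fin (n i)) (Fin r) ℝ :=
    Matrix.of fun p u => if u = v p.1 then h p.1 p.2 else 0
  have hblock : charMat (attachPaths B n m) l = Matrix.fromBlocks M Bm Bmᵀ D := by
    ext (u | p) (w | q)
    · simp only [charMat, attachPaths, hM, Matrix.of_apply, Sum.inl.injEq, Matrix.fromBlocks_apply₁₁]
      congr
    · simp only [charMat, attachPaths, Bm, hvm, hom, Matrix.of_apply, Matrix.fromBlocks_apply₁₂,
        reduceCtorEq]
      split_ifs <;> simp_all
    · simp only [charMat, attachPaths, Bm, hvm, hom, Matrix.of_apply, Matrix.fromBlocks_apply₂₁,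
        Matrix.transpose_apply, reduceCtorEq]
      split_ifs <;> simp_all
    · obtain ⟨i, a⟩ := p
      obtain ⟨j, b⟩ := q
      by_cases hij : i = j
      · subst hij
        simp [charMat, attachPaths, hD, Matrix.blockDiagonal'_apply_eq, SimpleGraph.pathGraph_adj]
      · rw [Matrix.fromBlocks_apply₂₂, hD, Matrix.blockDiagonal'_apply_ne _ _ _ hij]
        simp [charMat, attachPaths, hij]
  have hDW : Bmᵀ + D * W = 0 := by
    ext ⟨i, a⟩ u
    have key := congrFun (hh i) a
    rw [Matrix.mulVec, dotProduct] at key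
    simp only [Matrix.add_apply, Matrix.mul_apply, Fintype.sum_sigma, Matrix.zero_apply]
    rw [Finset.sum_eq_single i]
    · simp only [hD, Matrix.blockDiagonal'_apply_eq, W, Bm, Matrix.of_apply, Matrix.transpose_apply]
      by_cases hu : u = v i
      · simp only [hu, if_true, true_and]
        rw [key, Pi.single_apply]
        split_ifs <;> simp_all
      · simp [hu]
    · intro j _ hj
      refine Finset.sum_eq_zero fun b _ => ?_
      rw [hD, Matrix.blockDiagonal'_apply_ne _ _ _ (Ne.symm hj), zero_mul]
    · simp
  have hmul : Matrix.fromBlocks M Bm Bmᵀ D * Matrix.fromBlocks 1 0 W 1 =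
      Matrix.fromBlocks (M + Bm * W) Bm 0 D := by
    rw [Matrix.fromBlocks_multiply]
    simp [hDW]
  have hdet := congrArg Matrix.det hmul
  rw [Matrix.det_mul, Matrix.det_fromBlocks_zero₁₂, Matrix.det_fromBlocks_zero₂₁] at hdet
  simp only [Matrix.det_one, mul_one] at hdet
  -- The Schur correction factors through the two attachment vertices, so det(1 - UE) = det(1 - EU)
  -- reduces it to a 2×2 determinant.
  let U : Matrix (Fin r) (Fin 2) ℝ := Matrix.of fun u i => h i (o i) * g i u
  let E : Matrix (Fin 2) (Fin r) ℝ := Matrix.of fun i u => if u = v i then 1 else 0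
  have hBW : M + Bm * W = M * (1 - U * E) := by
    have hMU : M * U = Matrix.of fun u i => if u = v i then h i (o i) else 0 := by
      ext u i
      have key := congrFun (hg i) u
      rw [Matrix.mulVec, dotProduct] at key
      simp only [Matrix.mul_apply, U, Matrix.of_apply]
      calc _ = h i (o i) * ∑ x, M u x * g i x := by
            rw [Finset.mul_sum]; exact Finset.sum_congr rfl fun x _ => by ring
        _ = _ := by rw [key, Pi.single_apply]; simp
    rw [Matrix.mul_sub, Matrix.mul_one, ← Matrix.mul_assoc, hMU, sub_eq_add_neg]
    congr 1
    ext u w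
    simp only [Matrix.mul_apply, Fintype.sum_sigma, Matrix.neg_apply, ← Finset.sum_neg_distrib]
    refine Finset.sum_congr rfl fun i _ => ?_
    rw [Finset.sum_eq_single (o i)]
    · simp only [Bm, W, E, Matrix.of_apply]
      split_ifs <;> simp_all
    · intro b _ hb
      simp [Bm, hb]
    · simp
  rw [hblock, hdet, hBW, Matrix.det_mul, hD, det_blockDiagonal_dependent,
    Matrix.det_one_sub_mul_comm, Matrix.det_fin_two]
  simp [Fin.prod_univ_two, E, U, Matrix.mul_apply]
  ring

/-! ### Paths and cycles as three-term recurrences. -/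

lemma sum_fin_ite_intCast_eq (N : ℕ) (f : ℤ → ℝ) (a : ℤ) :
    ∑ j : Fin N, (if (j : ℤ) = a then f j else 0) = if 0 ≤ a ∧ a < N then f a else 0 := by
  split_ifs with h
  · rw [Finset.sum_eq_single ⟨a.toNat, by omega⟩]
    · simp [h.1]
    · intro b _ hb
      rw [if_neg]
      rintro rfl
      exact hb (Fin.ext (by simp))
    · simp
  · refine Finset.sum_eq_zero fun j _ => if_neg ?_
    have := j.2
    omega

/-- If the neighbours of `i` are `a ≠ b`, where out-of-range labels carry the value `0`, then
`l I - A(G)` acts at `i` as a three-term operator. -/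
lemma charMat_mulVec_of_adj {N : ℕ} (G : SimpleGraph (Fin N)) (l : ℝ) (f : ℤ → ℝ) (i : Fin N)
    (a b : ℤ) (hab : a ≠ b) (hG : ∀ j, G.Adj i j ↔ (j : ℤ) = a ∨ (j : ℤ) = b)
    (ha : ¬(0 ≤ a ∧ a < N) → f a = 0) (hb : ¬(0 ≤ b ∧ b < N) → f b = 0) :
    (charMat G l *ᵥ fun j => f j) i = l * f i - f a - f b := by
  classical
  have h1 : ∀ j : Fin N, charMat G l i j * f j =
      (if i = j then l * f j else 0) - (if (j : ℤ) = a then f j else 0) -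
        (if (j : ℤ) = b then f j else 0) := by
    intro j
    simp only [charMat, Matrix.of_apply, hG]
    split_ifs <;> first | (exfalso; omega) | ring
  rw [Matrix.mulVec, dotProduct]
  simp only [h1, Finset.sum_sub_distrib]
  rw [sum_fin_ite_intCast_eq, sum_fin_ite_intCast_eq]
  simp only [Finset.sum_ite_eq, Finset.mem_univ, if_true]
  congr 1
  · congr 1
    split_ifs with h
    · rfl
    · exact (ha h).symm
  · split_ifs with h
    · rfl
    · exact (hb h).symm

lemma charMat_pathGraph_mulVec {N : ℕ} (l : ℝ) (f : ℤ → ℝ) (h0 : f (-1) = 0) (hN : f N = 0)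
    (i : Fin N) :
    (charMat (SimpleGraph.pathGraph N) l *ᵥ fun j => f j) i =
      l * f i - f (i - 1) - f (i + 1) := by
  have hi := i.2
  refine charMat_mulVec_of_adj _ l f i _ _ (by omega) ?_ ?_ ?_
  · intro j
    rw [SimpleGraph.pathGraph_adj]
    omega
  · intro h
    rwa [show ((i : ℕ) : ℤ) - 1 = -1 by omega]
  · intro h
    rwa [show ((i : ℕ) : ℤ) + 1 = N by omega]

lemma cycleGraph_adj_iff_val {N : ℕ} (i j : Fin N) :
    (SimpleGraph.cycleGraph N).Adj i j ↔
      i ≠ j ∧ ((i : ℕ) + 1 = j ∨ (j : ℕ) + 1 = i ∨ ((i : ℕ) = 0 ∧ (j : ℕ) + 1 = N) ∨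
        ((j : ℕ) = 0 ∧ (i : ℕ) + 1 = N)) := by
  have hi := i.2
  have hj := j.2
  have key : ∀ a b : Fin N, (a - b).val = if b.val ≤ a.val then a.val - b.val
      else N - b.val + a.val := by
    intro a b
    have ha := a.2
    have hb := b.2
    rw [Fin.sub_def]
    split_ifs with h
    · simp only
      rw [show N - b.val + a.val = (a.val - b.val) + N by omega, Nat.add_mod_right]
      exact Nat.mod_eq_of_lt (by omega)
    · exact Nat.mod_eq_of_lt (by omega)
  rw [SimpleGraph.cycleGraph_adj', key, key, Ne, Fin.ext_iff]
  split_ifs <;> omega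

/-- Only the two wrap-around values of `f` are ever read, so full periodicity is not needed; 3 ≤ N
keeps the two neighbours distinct. -/
lemma charMat_cycleGraph_mulVec {N : ℕ} (hN : 3 ≤ N) (l : ℝ) (f : ℤ → ℝ)
    (h0 : f (-1) = f (N - 1)) (h1 : f N = f 0) (i : Fin N) :
    (charMat (SimpleGraph.cycleGraph N) l *ᵥ fun j => f j) i =
      l * f i - f (i - 1) - f (i + 1) := by
  have hi := i.2
  have ha : f (i - 1) = f (if (i : ℕ) = 0 then N - 1 else i - 1) := by
    split_ifs with h
    · rw [h, ← h0]; simp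
    · rfl
  have hb : f (i + 1) = f (if (i : ℕ) + 1 = N then 0 else i + 1) := by
    split_ifs with h
    · rw [← h1]; congr 1; omega
    · rfl
  rw [ha, hb]
  refine charMat_mulVec_of_adj _ l f i _ _ ?_ ?_ ?_ ?_
  · split_ifs <;> omega
  · intro j
    have hj := j.2
    rw [cycleGraph_adj_iff_val, Ne, Fin.ext_iff]
    split_ifs <;> omega
  · split_ifs <;> omega
  · split_ifs <;> omega

/-! ### Green functions and determinants of paths and cycles at z + 1/z. -/

/-- The function `i ↦ z⁻ⁱ - zⁱ` on the integers. -/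
noncomputable def hypSin (z : ℝ) (i : ℤ) : ℝ := z ^ (-i) - z ^ i

lemma hypSin_zero (z : ℝ) : hypSin z 0 = 0 := by simp [hypSin]

lemma hypSin_recurrence {z : ℝ} (hz : z ≠ 0) (i : ℤ) :
    (z + z⁻¹) * hypSin z i = hypSin z (i - 1) + hypSin z (i + 1) := by
  simp only [hypSin, neg_sub, neg_add, zpow_add₀ hz, zpow_sub₀ hz, zpow_one, zpow_neg]
  field_simp
  ring

lemma hypSin_pos {z : ℝ} (h0 : 0 < z) (h1 : z < 1) {i : ℤ} (hi : 0 < i) : 0 < hypSin z i := by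
  rw [hypSin, sub_pos]
  exact zpow_lt_zpow_right_of_lt_one₀ h0 h1 (by omega)

/-- A discrete Wronskian identity; it normalises the jump of the path Green function at its source.
-/
lemma hypSin_add_mul_sub {z : ℝ} (hz : z ≠ 0) (a b : ℤ) :
    hypSin z (a + 1) * hypSin z b - hypSin z a * hypSin z (b - 1) =
      hypSin z 1 * hypSin z (a + b) := by
  simp only [hypSin, neg_sub, neg_add, zpow_add₀ hz, zpow_sub₀ hz, zpow_one, zpow_neg]
  field_simp
  ring

/-- The Green function of the path. -/
noncomputable def pathGreen (z : ℝ) (N m : ℕ) (j : ℤ) : ℝ :=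
  (if j ≤ m then hypSin z (j + 1) * hypSin z (N - m) else hypSin z (m + 1) * hypSin z (N - j)) /
    (hypSin z 1 * hypSin z (N + 1))

lemma charMat_pathGraph_mulVec_pathGreen {z : ℝ} (h0 : 0 < z) (h1 : z < 1) {N : ℕ} (m : Fin N) :
    charMat (SimpleGraph.pathGraph N) (z + z⁻¹) *ᵥ (fun j => pathGreen z N m j) =
      Pi.single m 1 := by
  have hm := m.2
  have hc1 := (hypSin_pos h0 h1 (i := 1) (by omega)).ne'
  have hc2 := (hypSin_pos h0 h1 (i := N + 1) (by omega)).ne'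
  ext i
  rw [charMat_pathGraph_mulVec _ (pathGreen z N m)]
  · rw [Pi.single_apply]
    rcases lt_trichotomy (i : ℕ) m with h | h | h
    · have hrec := hypSin_recurrence h0.ne' ((i : ℤ) + 1)
      rw [if_neg (by rw [Fin.ext_iff]; omega)]
      rw [pathGreen, pathGreen, pathGreen, if_pos (by omega), if_pos (by omega), if_pos (by omega)]
      rw [show (i : ℤ) - 1 + 1 = i + 1 - 1 by ring]
      linear_combination hrec * hypSin z (N - (m : ℕ)) / (hypSin z 1 * hypSin z (N + 1))
    · have hrec := hypSin_recurrence h0.ne' ((i : ℤ) + 1)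
      have hadd := hypSin_add_mul_sub h0.ne' ((i : ℤ) + 1) (N - i)
      rw [if_pos (Fin.ext h)]
      rw [pathGreen, pathGreen, pathGreen, if_pos (by omega), if_pos (by omega), if_neg (by omega),
        ← h]
      rw [show (i : ℤ) - 1 + 1 = i + 1 - 1 by ring, show (N : ℤ) - (i + 1) = N - i - 1 by ring]
      rw [show (i : ℤ) + 1 + (N - i) = N + 1 by ring] at hadd
      have hone := div_self (mul_ne_zero hc1 hc2)
      linear_combination (hrec * hypSin z (N - (i : ℕ)) + hadd) /
        (hypSin z 1 * hypSin z (N + 1)) + hone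
    · have hrec := hypSin_recurrence h0.ne' ((N : ℤ) - i)
      rw [if_neg (by rw [Fin.ext_iff]; omega)]
      simp only [pathGreen]
      -- When i = m + 1 the left neighbour is the source, where the two branches agree.
      have hsplit : (if (i : ℤ) - 1 ≤ (m : ℕ) then hypSin z ((i : ℤ) - 1 + 1) * hypSin z (N - (m : ℕ))
          else hypSin z ((m : ℕ) + 1) * hypSin z (N - ((i : ℤ) - 1))) =
          hypSin z ((m : ℕ) + 1) * hypSin z (N - ((i : ℤ) - 1)) := by
        split_ifs with h'
        · rw [show (i : ℤ) = (m : ℕ) + 1 by omega]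
          ring_nf
        · rfl
      rw [hsplit, if_neg (show ¬(i : ℤ) ≤ (m : ℕ) by omega),
        if_neg (show ¬(i : ℤ) + 1 ≤ (m : ℕ) by omega), show (N : ℤ) - (i - 1) = N - i + 1 by ring,
        show (N : ℤ) - (i + 1) = N - i - 1 by ring]
      linear_combination hrec * hypSin z ((m : ℕ) + 1) / (hypSin z 1 * hypSin z (N + 1))
  · simp [pathGreen, hypSin_zero]
  · simp [pathGreen, hypSin_zero, hm]

/-- Deleting an end vertex leaves a shorter path, so the Green function at that end is the ratio of
consecutive determinants. -/
lemma det_charMat_pathGraph {z : ℝ} (h0 : 0 < z) (h1 : z < 1) (N : ℕ) :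
    (charMat (SimpleGraph.pathGraph N) (z + z⁻¹)).det = hypSin z (N + 1) / hypSin z 1 := by
  have hc1 := (hypSin_pos h0 h1 (i := 1) (by omega)).ne'
  induction N with
  | zero => simp [hc1]
  | succ N ih =>
    have hc2 := (hypSin_pos h0 h1 (i := N + 1) (by omega)).ne'
    have hc3 := (hypSin_pos h0 h1 (i := N + 1 + 1) (by omega)).ne'
    have hdet := det_mul_apply_of_mulVec_eq_single _ _ _ _
      (charMat_pathGraph_mulVec_pathGreen h0 h1 (0 : Fin (N + 1)))
    rw [Matrix.adjugate_fin_succ_eq_det_submatrix] at hdet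
    have hsub : (charMat (SimpleGraph.pathGraph (N + 1)) (z + z⁻¹)).submatrix
        (Fin.succAbove 0) (Fin.succAbove 0) = charMat (SimpleGraph.pathGraph N) (z + z⁻¹) := by
      ext a b
      simp [charMat, SimpleGraph.pathGraph_adj]
    rw [hsub, ih] at hdet
    simp [pathGreen] at hdet
    push_cast
    field_simp at hdet ⊢
    linear_combination hdet

/-- The Green function of the cycle. -/
noncomputable def cycleGreen (z : ℝ) (N m : ℕ) (j : ℤ) : ℝ :=
  (z ^ |j - m| + z ^ (N - |j - m|)) / (hypSin z 1 * (1 - z ^ N))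

lemma charMat_cycleGraph_mulVec_cycleGreen {z : ℝ} (h0 : 0 < z) (h1 : z < 1) {N : ℕ}
    (hN : 3 ≤ N) (m : Fin N) :
    charMat (SimpleGraph.cycleGraph N) (z + z⁻¹) *ᵥ (fun j => cycleGreen z N m j) =
      Pi.single m 1 := by
  have hm := m.2
  have hc1 := (hypSin_pos h0 h1 (i := 1) (by omega)).ne'
  have hc2 : 1 - z ^ N ≠ 0 := (sub_pos.2 (pow_lt_one₀ h0.le h1 (by omega))).ne'
  have hz := h0.ne'
  ext i
  rw [charMat_cycleGraph_mulVec hN _ (cycleGreen z N m)]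
  · rw [Pi.single_apply]
    rcases lt_trichotomy (i : ℕ) m with h | h | h
    · rw [if_neg (by rw [Fin.ext_iff]; omega)]
      simp only [cycleGreen]
      rw [abs_of_nonpos (by omega), abs_of_nonpos (by omega), abs_of_nonpos (by omega)]
      simp only [sub_eq_add_neg, neg_add, neg_neg, zpow_add₀ hz, zpow_neg, zpow_one]
      field_simp
      ring
    · rw [if_pos (Fin.ext h)]
      simp only [cycleGreen, ← h]
      rw [div_eq_mul_inv, div_eq_mul_inv, div_eq_mul_inv, ← mul_assoc, ← sub_mul, ← sub_mul,
        ← div_eq_mul_inv, div_eq_one_iff_eq (mul_ne_zero hc1 hc2)]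
      simp [hypSin, zpow_sub₀ hz]
      field_simp
      ring
    · rw [if_neg (by rw [Fin.ext_iff]; omega)]
      simp only [cycleGreen]
      rw [abs_of_nonneg (by omega), abs_of_nonneg (by omega), abs_of_nonneg (by omega)]
      simp only [sub_eq_add_neg, neg_add, neg_neg, zpow_add₀ hz, zpow_neg, zpow_one]
      field_simp
      ring
  -- Going once round the cycle swaps the two arc lengths d and N - d, and the numerator is
  -- symmetric in them.
  · simp only [cycleGreen]
    rw [abs_of_neg (by omega), abs_of_nonneg (by omega)]
    rw [add_comm]
    ring_nf
  · simp only [cycleGreen]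
    rw [abs_of_nonneg (by omega), abs_of_nonpos (by omega)]
    rw [add_comm]
    ring_nf

/-- Deleting a vertex leaves a path; the factor 1 + z^N common to its determinant and the diagonal
Green function cancels. -/
lemma det_charMat_cycleGraph {z : ℝ} (h0 : 0 < z) (h1 : z < 1) {N : ℕ} (hN : 3 ≤ N) :
    (charMat (SimpleGraph.cycleGraph N) (z + z⁻¹)).det = (1 - z ^ N) ^ 2 / z ^ N := by
  obtain ⟨N, rfl⟩ : ∃ M, N = M + 1 := ⟨N - 1, by omega⟩
  have hc1 := (hypSin_pos h0 h1 (i := 1) (by omega)).ne'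
  have hc2 : 1 - z ^ (N + 1) ≠ 0 := (sub_pos.2 (pow_lt_one₀ h0.le h1 (by omega))).ne'
  have hc3 : 1 + z ^ (N + 1) ≠ 0 := by positivity
  have hz := h0.ne'
  have hdet := det_mul_apply_of_mulVec_eq_single _ _ _ _
    (charMat_cycleGraph_mulVec_cycleGreen h0 h1 hN (0 : Fin (N + 1)))
  rw [Matrix.adjugate_fin_succ_eq_det_submatrix] at hdet
  have hsub : (charMat (SimpleGraph.cycleGraph (N + 1)) (z + z⁻¹)).submatrix
      (Fin.succAbove 0) (Fin.succAbove 0) = charMat (SimpleGraph.pathGraph N) (z + z⁻¹) := by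
    ext a b
    have : (SimpleGraph.cycleGraph (N + 1)).Adj a.succ b.succ ↔
        (SimpleGraph.pathGraph N).Adj a b := by
      rw [cycleGraph_adj_iff_val, SimpleGraph.pathGraph_adj, Ne, Fin.ext_iff]
      simp
      omega
    by_cases hadj : (SimpleGraph.pathGraph N).Adj a b
    · simp [charMat, this.2 hadj, hadj]
    · simp [charMat, mt this.1 hadj, hadj]
  rw [hsub, det_charMat_pathGraph h0 h1] at hdet
  have hpow : hypSin z (N + 1) = (1 - z ^ (N + 1)) * (1 + z ^ (N + 1)) / z ^ (N + 1) := by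
    rw [hypSin, show (N : ℤ) + 1 = ((N + 1 : ℕ) : ℤ) by push_cast; rfl, zpow_neg, zpow_natCast]
    field_simp
    ring
  have hg : cycleGreen z (N + 1) 0 0 = (1 + z ^ (N + 1)) / (hypSin z 1 * (1 - z ^ (N + 1))) := by
    simp [cycleGreen, ← zpow_natCast]
  rw [hpow] at hdet
  simp [hg] at hdet
  field_simp at hdet ⊢
  linear_combination hdet

lemma pathGreen_of_le (z : ℝ) (N m : ℕ) {j : ℕ} (h : j ≤ m) :
    pathGreen z N m j =
      hypSin z (j + 1) * hypSin z (N - m) / (hypSin z 1 * hypSin z (N + 1)) := by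
  rw [pathGreen, if_pos (by omega)]

lemma pathGreen_of_lt (z : ℝ) (N m : ℕ) {j : ℕ} (h : m < j) :
    pathGreen z N m j =
      hypSin z (m + 1) * hypSin z (N - j) / (hypSin z 1 * hypSin z (N + 1)) := by
  rw [pathGreen, if_neg (by omega)]

lemma cycleGreen_of_abs_eq (z : ℝ) (N m d e : ℕ) {j : ℕ} (h : |(j : ℤ) - m| = d)
    (he : d + e = N) :
    cycleGreen z N m j = (z ^ d + z ^ e) / (hypSin z 1 * (1 - z ^ N)) := by
  rw [cycleGreen, h, show (N : ℤ) - d = (e : ℕ) by omega, zpow_natCast, zpow_natCast]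

/-! ### Closed forms for the two families. -/

/-- Evaluation of the characteristic polynomial of a graph with two pendant paths attached at
`z + z⁻¹`. -/
lemma det_charMat_attachPaths_hypSin {z : ℝ} (h0 : 0 < z) (h1 : z < 1) {r : ℕ}
    (B : SimpleGraph (Fin r)) (n m : Fin 2 → ℕ) (hn : ∀ i, 0 < n i) (hm : ∀ i, m i < r)
    (g : ℕ → ℤ → ℝ)
    (hg : ∀ v : Fin r, charMat B (z + z⁻¹) *ᵥ (fun j => g v j) = Pi.single v 1) :
    (charMat (attachPaths B n m) (z + z⁻¹)).det =
      (charMat B (z + z⁻¹)).det * (hypSin z (n 0 + 1) / hypSin z 1) *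
        (hypSin z (n 1 + 1) / hypSin z 1) *
        ((1 - hypSin z (n 0) / hypSin z (n 0 + 1) * g (m 0) (m 0)) *
          (1 - hypSin z (n 1) / hypSin z (n 1 + 1) * g (m 1) (m 1)) -
          hypSin z (n 0) / hypSin z (n 0 + 1) * (hypSin z (n 1) / hypSin z (n 1 + 1)) *
            g (m 0) (m 1) * g (m 1) (m 0)) := by
  have hc1 := (hypSin_pos h0 h1 (i := 1) (by omega)).ne'
  have hp : ∀ i, pathGreen z (n i) 0 0 = hypSin z (n i) / hypSin z (n i + 1) := by
    intro i
    have := pathGreen_of_le z (n i) 0 (le_refl 0)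
    simp only [Nat.cast_zero, zero_add, sub_zero] at this
    rw [this, mul_div_mul_left _ _ hc1]
  have key := det_charMat_attachPaths B n m (z + z⁻¹) (fun i => ⟨m i, hm i⟩) (fun _ => rfl)
    (fun i j => g (m i) j) (fun i => hg ⟨m i, hm i⟩) (fun i => ⟨0, hn i⟩) (fun _ => rfl)
    (fun i j => pathGreen z (n i) 0 j)
    (fun i => charMat_pathGraph_mulVec_pathGreen h0 h1 ⟨0, hn i⟩)
  simp only [Nat.cast_zero, hp, det_charMat_pathGraph h0 h1] at key
  exact key

lemma eval_graphCharpoly_closedQuipu {z : ℝ} (h0 : 0 < z) (h1 : z < 1) {t s k : ℕ} (ht : 0 < t)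
    (hs : 2 ≤ s) (hk : k ≤ s) :
    (graphCharpoly (closedQuipu ![1, t] ![0, k] (2 * s))).eval (z + z⁻¹) =
      ((hypSin z 2 * (1 - z ^ (2 * s)) - (1 + z ^ (2 * s))) *
        (hypSin z (t + 1) * hypSin z 1 * (1 - z ^ (2 * s)) - hypSin z t * (1 + z ^ (2 * s))) -
        hypSin z t * (z ^ k + z ^ (2 * s - k)) ^ 2) / (z ^ (2 * s) * hypSin z 1 ^ 3) := by
  have hc1 := (hypSin_pos h0 h1 (i := 1) (by omega)).ne'
  have hc2 := (hypSin_pos h0 h1 (i := 2) (by omega)).ne'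
  have hct := (hypSin_pos h0 h1 (i := t + 1) (by omega)).ne'
  have hq : 1 - z ^ (2 * s) ≠ 0 := (sub_pos.2 (pow_lt_one₀ h0.le h1 (by omega))).ne'
  have hz := h0.ne'
  rw [eval_graphCharpoly, closedQuipu, det_charMat_attachPaths_hypSin h0 h1 _ _ _
    (by intro i; fin_cases i <;> (simp; try omega))
    (by intro i; fin_cases i <;> (simp; try omega))
    (cycleGreen z (2 * s)) (fun v => charMat_cycleGraph_mulVec_cycleGreen h0 h1 (by omega) v),
    det_charMat_cycleGraph h0 h1 (by omega)]
  simp only [Matrix.cons_val_zero, Matrix.cons_val_one, Nat.cast_one, one_add_one_eq_two]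
  rw [cycleGreen_of_abs_eq z (2 * s) 0 0 (2 * s) (by simp) (by omega),
    cycleGreen_of_abs_eq z (2 * s) k 0 (2 * s) (by simp) (by omega),
    cycleGreen_of_abs_eq z (2 * s) 0 k (2 * s - k) (by simp) (by omega),
    cycleGreen_of_abs_eq z (2 * s) k k (2 * s - k) (by simp) (by omega)]
  generalize z ^ (2 * s) = w at *
  generalize z ^ k + z ^ (2 * s - k) = v at *
  field_simp

lemma eval_graphCharpoly_treeH {z : ℝ} (h0 : 0 < z) (h1 : z < 1) {n : ℕ} (hn : 10 ≤ n) :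
    (graphCharpoly (treeH n)).eval (z + z⁻¹) =
      hypSin z 3 ^ 2 * (hypSin z 1 ^ 2 * hypSin z (n - 3) -
        2 * hypSin z 1 * hypSin z 2 * hypSin z (n - 6) + hypSin z 2 ^ 2 * hypSin z (n - 9)) /
        hypSin z 1 ^ 5 := by
  have hc1 := (hypSin_pos h0 h1 (i := 1) (by omega)).ne'
  have hc2 := (hypSin_pos h0 h1 (i := 2) (by omega)).ne'
  have hc3 := (hypSin_pos h0 h1 (i := 3) (by omega)).ne'
  have hcn := (hypSin_pos h0 h1 (i := n - 3) (by omega)).ne'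
  have hz := h0.ne'
  -- A Catalan-type identity: it makes the 2×2 determinant of Green values divisible by `hypSin z (n
  -- - 3)`, which cancels the remaining denominator.
  have hprod : hypSin z (n - 3) * hypSin z (n - 9) = hypSin z (n - 6) ^ 2 - hypSin z 3 ^ 2 := by
    rw [show (n : ℤ) - 3 = (n - 6) + 3 by ring, show (n : ℤ) - 9 = (n - 6) - 3 by ring]
    simp only [hypSin, neg_sub, neg_add, zpow_add₀ hz, zpow_sub₀ hz, zpow_neg]
    field_simp
    ring
  rw [eval_graphCharpoly, treeH, openQuipu, det_charMat_attachPaths_hypSin h0 h1 _ _ _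
    (by intro i; fin_cases i <;> simp) (by intro i; fin_cases i <;> (simp; try omega))
    (pathGreen z (n - 4)) (fun v => charMat_pathGraph_mulVec_pathGreen h0 h1 v),
    det_charMat_pathGraph h0 h1]
  simp only [Matrix.cons_val_zero, Matrix.cons_val_one]
  rw [pathGreen_of_le z (n - 4) 2 le_rfl, pathGreen_of_le z (n - 4) (n - 7) le_rfl,
    pathGreen_of_lt z (n - 4) 2 (by omega), pathGreen_of_le z (n - 4) (n - 7) (by omega)]
  push_cast [show 4 ≤ n by omega, show 7 ≤ n by omega]
  rw [show (n : ℤ) - 4 + 1 = n - 3 by ring, show (n : ℤ) - 4 - 2 = n - 6 by ring,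
    show (n : ℤ) - 7 + 1 = n - 6 by ring, show (n : ℤ) - 4 - (n - 7) = 3 by ring]
  field_simp
  linear_combination -hypSin z 2 ^ 2 * hprod

/-! ### Comparison of the two sides as z → 0. -/

lemma natDegree_graphCharpoly {V : Type*} [Fintype V] [DecidableEq V] (G : SimpleGraph V) :
    (graphCharpoly G).natDegree = Fintype.card V := by
  classical
  rw [graphCharpoly, Matrix.charpoly_natDegree_eq_dim]

lemma monic_graphCharpoly {V : Type*} [Fintype V] [DecidableEq V] (G : SimpleGraph V) :
    (graphCharpoly G).Monic := by
  classical
  exact Matrix.charpoly_monic _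

/-- The difference of the two sides, in terms of `T = z^(t-2)`, `S = z^(s-4)`, `b = z^(k-2)` and
`c = z^(s-k)`, after removing nonvanishing factors. -/
noncomputable def quipuResidual (z T S b c : ℝ) : ℝ :=
  2 - 2 * z ^ 2 - 3 * z ^ 4 + z ^ 6 + z ^ 8
    - S ^ 4 * T ^ 2 * z ^ 4 * (2 * z ^ 8 - 2 * z ^ 6 - 3 * z ^ 4 + z ^ 2 + 1)
    - ((T ^ 2 - S ^ 4 * z ^ 12) - (T ^ 2 * z ^ 2 - S ^ 4 * z ^ 10) - (T ^ 2 * z ^ 4 - S ^ 4 * z ^ 8)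
      - 2 * (S ^ 2 - S ^ 2 * T ^ 2 * z ^ 12) + 2 * (S ^ 2 * z ^ 2 - S ^ 2 * T ^ 2 * z ^ 10)
      + 2 * (S ^ 2 * z ^ 4 - S ^ 2 * T ^ 2 * z ^ 8) - 2 * (S ^ 2 * z ^ 6 - S ^ 2 * T ^ 2 * z ^ 6)
      - (b ^ 2 - S ^ 2 * c ^ 2 * T ^ 2 * z ^ 8) - (S ^ 2 * c ^ 2 * z ^ 4 - T ^ 2 * b ^ 2 * z ^ 4))

lemma quipuResidual_eq_zero {z : ℝ} (h0 : 0 < z) (h1 : z < 1) {t s k d : ℕ} (hd : k + d = s + 2)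
    (h : (X ^ 2 - 1) *
      graphCharpoly (closedQuipu ![1, t + 2] ![0, k + 2] (2 * (s + 4))) =
        graphCharpoly (treeH (2 * (s + 4) + (t + 2) + 3))) :
    quipuResidual z (z ^ t) (z ^ s) (z ^ k) (z ^ d) = 0 := by
  have hc1 := (hypSin_pos h0 h1 (i := 1) (by omega)).ne'
  have hc3 := (hypSin_pos h0 h1 (i := 3) (by omega)).ne'
  have hz := h0.ne'
  have hev := congrArg (Polynomial.eval (z + z⁻¹)) h
  rw [Polynomial.eval_mul, eval_graphCharpoly_closedQuipu h0 h1 (by omega) (by omega) (by omega),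
    eval_graphCharpoly_treeH h0 h1 (by omega)] at hev
  -- λ² - 1 is the characteristic polynomial of P₂; it cancels one of the two factors `hypSin z 3`
  -- of the tree.
  have hl : (X ^ 2 - 1 : ℝ[X]).eval (z + z⁻¹) = hypSin z 3 / hypSin z 1 := by
    rw [eq_div_iff hc1]
    simp [hypSin]
    field_simp
    ring
  rw [hl] at hev
  set w := z ^ (2 * (s + 4)) with hw
  -- Eliminating s through k + d = s + 2 leaves a rational identity in the independent quantities z,
  -- z^k, z^d and z^t.
  have hS : z ^ s = z ^ k * z ^ d / z ^ 2 := by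
    rw [eq_div_iff (by positivity), ← pow_add, ← pow_add, hd]
  have hw' : w = (z ^ k * z ^ d * z ^ 2) ^ 2 := by
    rw [hw, ← pow_add, hd]; ring
  have hwne : w ≠ 0 := by positivity
  have hv : z ^ (k + 2) + z ^ (2 * (s + 4) - (k + 2)) = z ^ k * z ^ 2 + z ^ k * (z ^ d) ^ 2 * z ^ 2 := by
    rw [show 2 * (s + 4) - (k + 2) = k + d + d + 2 by omega]; ring
  rw [hv] at hev
  push_cast at hev
  rw [show (2 * ((s : ℤ) + 4) + (t + 2) + 3 - 3) = (k + d) + (k + d) + t + 6 by omega,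
    show (2 * ((s : ℤ) + 4) + (t + 2) + 3 - 6) = (k + d) + (k + d) + t + 3 by omega,
    show (2 * ((s : ℤ) + 4) + (t + 2) + 3 - 9) = (k + d) + (k + d) + t by omega] at hev
  have hev' : hypSin z 1 * ((hypSin z 2 * (1 - w) - (1 + w)) *
        (hypSin z (t + 2 + 1) * hypSin z 1 * (1 - w) - hypSin z (t + 2) * (1 + w)) -
        hypSin z (t + 2) * (z ^ k * z ^ 2 + z ^ k * (z ^ d) ^ 2 * z ^ 2) ^ 2) =
      w * hypSin z 3 * (hypSin z 1 ^ 2 * hypSin z ((k + d) + (k + d) + t + 6) -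
        2 * hypSin z 1 * hypSin z 2 * hypSin z ((k + d) + (k + d) + t + 3) +
        hypSin z 2 ^ 2 * hypSin z ((k + d) + (k + d) + t)) := by
    field_simp at hev
    linear_combination hev
  have e1 : hypSin z 1 = (1 - z ^ 2) / z := by
    simp only [hypSin, zpow_neg, zpow_one]; field_simp
  have hfac : quipuResidual z (z ^ t) (z ^ s) (z ^ k) (z ^ d) * hypSin z 1 = 0 := by
    have key : quipuResidual z (z ^ t) (z ^ s) (z ^ k) (z ^ d) * hypSin z 1 * w =
        (z ^ k) ^ 2 * (z ^ d) ^ 2 * z ^ t * z ^ 2 *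
        (w * hypSin z 3 * (hypSin z 1 ^ 2 * hypSin z ((k + d) + (k + d) + t + 6) -
        2 * hypSin z 1 * hypSin z 2 * hypSin z ((k + d) + (k + d) + t + 3) +
        hypSin z 2 ^ 2 * hypSin z ((k + d) + (k + d) + t)) -
        hypSin z 1 * ((hypSin z 2 * (1 - w) - (1 + w)) *
        (hypSin z (t + 2 + 1) * hypSin z 1 * (1 - w) - hypSin z (t + 2) * (1 + w)) -
        hypSin z (t + 2) * (z ^ k * z ^ 2 + z ^ k * (z ^ d) ^ 2 * z ^ 2) ^ 2)) := by
      rw [hS, hw']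
      have e2 : hypSin z 2 = (1 - z ^ 4) / z ^ 2 := by
        simp only [hypSin, zpow_neg]; norm_cast; field_simp
      have e3 : hypSin z 3 = (1 - z ^ 6) / z ^ 3 := by
        simp only [hypSin, zpow_neg]; norm_cast; field_simp
      rw [e1, e2, e3]
      simp only [hypSin, zpow_neg]
      norm_cast
      simp only [pow_add, pow_one]
      have hb : z ^ k ≠ 0 := pow_ne_zero _ hz
      have hc : z ^ d ≠ 0 := pow_ne_zero _ hz
      have hT : z ^ t ≠ 0 := pow_ne_zero _ hz
      generalize z ^ k = b at *
      generalize z ^ d = c at *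
      generalize z ^ t = T at *
      rw [quipuResidual]
      field_simp
      ring
    rw [hev', sub_self, mul_zero] at key
    exact (mul_eq_zero.1 key).resolve_right hwne
  exact (mul_eq_zero.1 hfac).resolve_right hc1

theorem mainTheorem12 (n : ℕ) (hn : 12 ≤ n) :
    ¬ ∃ t s k : ℕ, 1 < t ∧ 3 < s ∧ 1 < k ∧ k ≤ s ∧
      (X ^ 2 - 1) * graphCharpoly (closedQuipu ![1, t] ![0, k] (2 * s)) =
        graphCharpoly (treeH n) := by
  rintro ⟨t, s, k, ht, hs, hk, hks, h⟩
  have hdeg := congrArg Polynomial.natDegree h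
  have hX : (X ^ 2 - 1 : ℝ[X]) = X ^ 2 - C 1 := by simp
  rw [Polynomial.natDegree_mul (by rw [hX]; exact (monic_X_pow_sub_C 1 (by norm_num)).ne_zero)
    (monic_graphCharpoly _).ne_zero, hX, natDegree_X_pow_sub_C, natDegree_graphCharpoly,
    natDegree_graphCharpoly] at hdeg
  simp [Fin.sum_univ_two] at hdeg
  -- These shifts keep every exponent of the residual a natural number, so it extends continuously
  -- to z = 0.
  obtain ⟨t, rfl⟩ : ∃ a, t = a + 2 := ⟨t - 2, by omega⟩
  obtain ⟨s, rfl⟩ : ∃ a, s = a + 4 := ⟨s - 4, by omega⟩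
  obtain ⟨k, rfl⟩ : ∃ a, k = a + 2 := ⟨k - 2, by omega⟩
  obtain ⟨d, hd⟩ : ∃ d, k + d = s + 2 := ⟨s + 2 - k, by omega⟩
  obtain rfl : n = 2 * (s + 4) + (t + 2) + 3 := by omega
  let F : ℝ → ℝ := fun z => quipuResidual z (z ^ t) (z ^ s) (z ^ k) (z ^ d)
  have hF : Continuous F := by
    unfold F quipuResidual
    fun_prop
  have hlim : F 0 = 0 := by
    refine tendsto_nhds_unique (hF.continuousAt.tendsto.mono_left nhdsWithin_le_nhds)
      (tendsto_const_nhds.congr' ?_ : Filter.Tendsto F (nhdsWithin 0 (Set.Ioi 0)) _)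
    filter_upwards [Ioo_mem_nhdsGT (zero_lt_one' ℝ)] with z hz
    exact (quipuResidual_eq_zero hz.1 hz.2 hd h).symm
  -- Here 0^0 = 1 matters. With T = 0^t, S = 0^s and b = 0^k, the value at 0 is 2 - T² + 2S² + b²,
  -- and T² is its only negative term.
  have hT : ((0 : ℝ) ^ t) ^ 2 ≤ 1 := by
    rcases Nat.eq_zero_or_pos t with rfl | hpos
    · simp
    · simp [hpos.ne']
  simp only [F, quipuResidual] at hlim
  nlinarith [sq_nonneg ((0 : ℝ) ^ s), sq_nonneg ((0 : ℝ) ^ k)]
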